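/- Let $(\Omega,\mathcal F,Q)$ be a probability space with a filtration $(\mathcal F_k)_{k\ge 0}$, and let $(x_{k1},x_{k2},y_k)$, $k\ge 1$, be a sequence of triplets of random variables such that $(x_{k1},x_{k2},y_k)$ is $\mathcal F_k$-measurable for every $k$; here the forecasts $x_{k1},x_{k2}$ take values in a measurable space $\mathcal X$ and the observations $y_k$ in a measurable space $\mathcal Y$ (for instance $\mathcal X=\mathcal Y=\mathbb R$). Let $\Theta$ be an arbitrary index set (for instance an interval in $\mathbb R$) and let $\{S_\theta:\theta\in\Theta\}$ be a family of measurable scoring functions $S_\theta:\mathcal X\times\mathcal Y\to\mathbb R$. Put $$d_k(\theta)=S_\theta(x_{k1},y_k)-S_\theta(x_{k2},y_k),\qquad \widetilde d_k(\theta)=d_k(\theta)-E[\,d_k(\theta)\mid\mathcal F_{k-1}],\qquad \widetilde D_n(\theta)=n^{-1/2}\sum_{k\le n}\widetilde d_k(\theta),$$ where $E$ denotes expectation with respect to $Q$. Suppose that there is a non-random function $\widetilde\gamma:\Theta\times\Theta\to\mathbb R$ such that $\widetilde\gamma(\theta,\theta)>0$ for all $\theta\in\Theta$ and, for every pair $\theta_1,\theta_2\in\Theta$,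 $$n^{-1}\sum_{k\le n}\widetilde d_k(\theta_1)\,\widetilde d_k(\theta_2)\longrightarrow\widetilde\gamma(\theta_1,\theta_2)\quad\text{in probability as } n\to\infty.$$ Suppose moreover that the Lindeberg condition $$\limsup_{n\to\infty}\ n^{-1}\sum_{k\le n}E\bigl\{d_k(\theta)^2\,\mathbf 1_{|d_k(\theta)|>\epsilon\sqrt n}\bigr\}=0\qquad(\theta\in\Theta,\ \epsilon>0)$$ holds. (It entails that every $d_k(\theta)$ is square integrable, so that the conditional expectations above are well defined.) Then there exists a mean zero Gaussian process $\widetilde Z=\{\widetilde Z(\theta):\theta\in\Theta\}$ with covariance function $\widetilde\gamma$, and the finite-dimensional distributions of the process $\widetilde D_n$ converge to those of $\widetilde Z$ as $n\to\infty$: for all finite sets $\{\theta_1,\dots,\theta_m\}\subset\Theta$, $(\widetilde D_n(\theta_1),\dots,\widetilde D_n(\theta_m))$ converges in distribution to $(\widetilde Z(\theta_1),\dots,\widetilde Z(\theta_m))$. -/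

import Mathlib

open MeasureTheory ProbabilityTheory Filter
open scoped ENNReal

/-- The score difference `d_k(θ) = S_θ(x_{k1}, y_k) - S_θ(x_{k2}, y_k)`. -/
def scoreDiff {Θ Ω 𝒳 𝒴 : Type*} (S : Θ → 𝒳 → 𝒴 → ℝ) (x₁ x₂ : ℕ → Ω → 𝒳) (y : ℕ → Ω → 𝒴)
    (k : ℕ) (θ : Θ) (ω : Ω) : ℝ :=
  S θ (x₁ k ω) (y k ω) - S θ (x₂ k ω) (y k ω)

/-- The conditionally centered variables `d_k(θ) - E[d_k(θ) | F_{k-1}]`, for `k ≥ 1`. -/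
noncomputable def condCentered {Θ Ω : Type*} {mΩ : MeasurableSpace Ω} (Q : Measure Ω)
    (ℱ : Filtration ℕ mΩ) (d : ℕ → Θ → Ω → ℝ) (k : ℕ) (θ : Θ) : Ω → ℝ :=
  fun ω => d k θ ω - (Q[d k θ | ℱ (k - 1)]) ω

/-- The normalized sum process `θ ↦ n^{-1/2} ∑_{k=1}^n e_k(θ)`. -/
noncomputable def normalizedSum {Θ Ω : Type*} (e : ℕ → Θ → Ω → ℝ) (n : ℕ) (θ : Θ) (ω : Ω) : ℝ :=
  (√(n : ℝ))⁻¹ * ∑ k ∈ Finset.Icc 1 n, e k θ ω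

/-- The empirical covariance `n^{-1} ∑_{k=1}^n e_k(θ₁) e_k(θ₂)`. -/
noncomputable def empiricalCov {Θ Ω : Type*} (e : ℕ → Θ → Ω → ℝ) (n : ℕ) (θ₁ θ₂ : Θ) (ω : Ω) : ℝ :=
  (n : ℝ)⁻¹ * ∑ k ∈ Finset.Icc 1 n, e k θ₁ ω * e k θ₂ ω

/-- The Lindeberg condition: for every `θ` and every `ε > 0`,
`limsup_n n^{-1} ∑_{k=1}^n E{d_k(θ)² 1_{|d_k(θ)| > ε √n}} = 0`. The expectations are integrals of
nonnegative functions with values in `[0, ∞]`, so the condition includes their finiteness for all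
large `n`, and hence the square integrability of every `d_k(θ)` with `k ≥ 1`. -/
def LindebergCondition {Θ Ω : Type*} {mΩ : MeasurableSpace Ω} (Q : Measure Ω)
    (d : ℕ → Θ → Ω → ℝ) : Prop :=
  ∀ θ : Θ, ∀ ε : ℝ, 0 < ε →
    limsup (fun n : ℕ => (n : ℝ≥0∞)⁻¹ * ∑ k ∈ Finset.Icc 1 n,
      ∫⁻ ω, Set.indicator {ω | ε * √(n : ℝ) < |d k θ ω|}
        (fun ω => ENNReal.ofReal (d k θ ω ^ 2)) ω ∂Q) atTop = 0

/-- The process `Z` under `P` is a mean zero Gaussian process with covariance function `γ`. -/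
def IsCenteredGaussianProcess {Θ Ω : Type*} {mΩ : MeasurableSpace Ω} (Z : Θ → Ω → ℝ)
    (P : Measure Ω) (γ : Θ → Θ → ℝ) : Prop :=
  IsGaussianProcess Z P ∧ (∀ θ, ∫ ω, Z θ ω ∂P = 0) ∧ ∀ θ₁ θ₂, cov[Z θ₁, Z θ₂; P] = γ θ₁ θ₂

/-- Convergence of the finite-dimensional distributions of the processes `X n` to those of `Z`. -/
def TendstoInFiniteDimDistributions {Θ Ω Ω' : Type*} {mΩ : MeasurableSpace Ω}
    {mΩ' : MeasurableSpace Ω'} (X : ℕ → Θ → Ω → ℝ) (Z : Θ → Ω' → ℝ)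
    (Q : Measure Ω) [IsProbabilityMeasure Q] (P : Measure Ω') [IsProbabilityMeasure P] : Prop :=
  ∀ I : Finset Θ, TendstoInDistribution (fun n ω => I.restrict (X n · ω)) atTop
    (fun ω => I.restrict (Z · ω)) (fun _ => Q) P

/-! The centered variables are martingale differences, and the proof reduces to McLeish's argument
in each direction. For `t` in `I → ℝ`, put `X n k = n^{-1/2} ∑ i, t i * e (k+1) (θ i)`, where `e`
denotes the centered variables. The squares of row `n` sum to the quadratic form of the empirical
covariance, so they converge in probability to `s = ∑ t i t j γ(θ i, θ j)`. The same identity makes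
`γ` positive semidefinite, so Kolmogorov's extension theorem provides the Gaussian process.

The core is the approximation `exp(ix) ≈ (1 + ix) exp(-x²/2)`. Multiplied over a row it gives
`exp(iS) ≈ T exp(-s/2)` with `T = ∏ (1 + i X n k)`, once the increments are small and their squares
sum to nearly `s`. Stopping the factors when the past squares exceed `C = s + 1` keeps the mean of
`T` exactly 1 (`integral_prod_truncateBySquares`) and bounds `‖T‖` by `exp C * (1 + max X²)`
(`norm_prod_truncateBySquares_le`). Hence `E exp(iS)` tends to `exp(-s/2)`. The Lindeberg condition
enters only through square integrability and the bound that makes `max X²` small in mean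
(`LindebergCondition.exists_bound_condCentered_sq`). Lévy's continuity theorem then gives joint
convergence. -/

/-! ### Kolmogorov's extension theorem -/

section Kolmogorov

open Topology

/-- A sequence of cylinders with compact bases has a common point as soon as each of its finite
subfamilies does. -/
lemma nonempty_iInter_cylinder_of_isCompact {ι : Type*} (s : ℕ → Finset ι)
    (K : ∀ n, Set (s n → ℝ)) (hK : ∀ n, IsCompact (K n))
    (h : ∀ n, (⋂ i ≤ n, cylinder (α := fun _ : ι => ℝ) (s i) (K i)).Nonempty) :
    (⋂ n, cylinder (α := fun _ : ι => ℝ) (s n) (K n)).Nonempty := by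
  classical
  choose x hx using h
  simp only [Set.mem_iInter, mem_cylinder] at hx
  -- One nonprincipal ultrafilter makes all the restrictions converge at once, which replaces a
  -- diagonal subsequence.
  have key : ∀ m, ∃ c ∈ K m, Tendsto (fun n => (s m).restrict (x n)) (hyperfilter ℕ) (𝓝 c) := by
    intro m
    have hle : ((hyperfilter ℕ).map fun n => (s m).restrict (x n) : Filter _) ≤ 𝓟 (K m) := by
      rw [le_principal_iff]
      have : ∀ᶠ n in (hyperfilter ℕ : Filter ℕ), m ≤ n :=
        (eventually_ge_atTop m).filter_mono Nat.hyperfilter_le_atTop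
      exact this.mono fun n hn => hx n m hn
    obtain ⟨c, hc, hc'⟩ := (hK m).ultrafilter_le_nhds _ hle
    exact ⟨c, hc, hc'⟩
  choose c hc hlim using key
  -- Coordinates outside every `s m` receive an arbitrary value, which no cylinder sees.
  refine ⟨fun t => limUnder (hyperfilter ℕ : Filter ℕ) fun n => x n t, ?_⟩
  simp only [Set.mem_iInter, mem_cylinder]
  intro m
  have : (s m).restrict (fun t => limUnder (hyperfilter ℕ : Filter ℕ) fun n => x n t) = c m := by
    funext t
    exact (tendsto_pi_nhds.1 (hlim m) t).limUnder_eq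
  rw [this]
  exact hc m

variable {ι : Type*} {P : ∀ J : Finset ι, Measure (J → ℝ)} [∀ J, IsProbabilityMeasure (P J)]

/-- Inner regularity: if the contents stayed above a positive number, compact bases could be chosen
inside those of `A n` with total loss below it. The losses then cannot cover any `A n`, so the
compact cylinders have the finite intersection property, and a common point contradicts the empty
intersection. -/
lemma tendsto_projectiveFamilyContent_zero
    (hP : IsProjectiveMeasureFamily (α := fun _ : ι => ℝ) P)
    {A : ℕ → Set (ι → ℝ)} (hA : ∀ n, A n ∈ measurableCylinders fun _ : ι => ℝ)
    (hanti : Antitone A) (hinter : ⋂ n, A n = ∅) :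
    Tendsto (fun n => projectiveFamilyContent hP (A n)) atTop (𝓝 0) := by
  classical
  have hmono : Antitone fun n => projectiveFamilyContent hP (A n) := fun m n hmn =>
    projectiveFamilyContent_mono hP (hA n) (hA m) (hanti hmn)
  have hlim := tendsto_atTop_iInf hmono
  suffices (⨅ n, projectiveFamilyContent hP (A n)) = 0 by rwa [this] at hlim
  by_contra hne
  obtain ⟨δ, hδ, hsum⟩ := ENNReal.exists_pos_sum_of_countable' hne ℕ
  choose s T hT hAeq using fun n => (mem_measurableCylinders _).1 (hA n)
  choose K hKT hK hlt using fun n =>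
    (hT n).exists_isCompact_sdiff_lt (measure_ne_top (P (s n)) (T n)) (hδ n).ne'
  have hKmeas : ∀ n, MeasurableSet (K n) := fun n => (hK n).measurableSet
  let C : ℕ → Set (ι → ℝ) := fun n => cylinder (s n) (K n)
  have hdiff : ∀ n, A n \ C n = cylinder (s n) (T n \ K n) := fun n => by
    rw [hAeq]; rfl
  have hdiff_mem : ∀ n, A n \ C n ∈ measurableCylinders fun _ : ι => ℝ := fun n => by
    rw [hdiff]; exact cylinder_mem_measurableCylinders _ _ ((hT n).diff (hKmeas n))
  have hdiff_le : ∀ n, projectiveFamilyContent hP (A n \ C n) ≤ δ n := fun n => by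
    rw [hdiff, projectiveFamilyContent_cylinder hP ((hT n).diff (hKmeas n))]
    exact (hlt n).le
  have hne_all : ∀ n, (⋂ i ≤ n, C i).Nonempty := by
    intro n
    by_contra hempty
    rw [Set.not_nonempty_iff_eq_empty] at hempty
    have hsub : A n ⊆ ⋃ i ≤ n, A i \ C i := by
      intro x hx
      by_contra hcon
      have : x ∈ ⋂ i ≤ n, C i := by
        simp only [Set.mem_iInter]
        intro i hi
        by_contra hxi
        exact hcon (Set.mem_biUnion (x := i) hi ⟨hanti hi hx, hxi⟩)
      rw [hempty] at this
      exact this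
    have hU : (⋃ i ≤ n, A i \ C i) ∈ measurableCylinders fun _ : ι => ℝ := by
      have := isSetRing_measurableCylinders.biUnion_mem (s := fun i => A i \ C i)
        (Finset.range (n + 1)) fun i _ => hdiff_mem i
      simpa only [Finset.mem_range_succ_iff] using this
    have h1 : projectiveFamilyContent hP (A n) ≤ ∑ i ∈ Finset.range (n + 1), δ i :=
      (projectiveFamilyContent_mono hP (hA n) hU hsub).trans
        ((projectiveFamilyContent_iUnion_le hP hdiff_mem n).trans
          (Finset.sum_le_sum fun i _ => hdiff_le i))
    have h2 := (iInf_le (fun n => projectiveFamilyContent hP (A n)) n).trans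
      (h1.trans (ENNReal.sum_le_tsum _))
    exact absurd hsum (not_lt.2 h2)
  obtain ⟨x, hx⟩ := nonempty_iInter_cylinder_of_isCompact s K hK hne_all
  have : x ∈ ⋂ n, A n := by
    simp only [Set.mem_iInter] at hx ⊢
    intro n
    rw [hAeq]
    exact hKT n (hx n)
  rw [hinter] at this
  exact this

/-- **Kolmogorov's extension theorem** for real-valued processes over an arbitrary index set. -/
theorem exists_isProjectiveLimit (hP : IsProjectiveMeasureFamily (α := fun _ : ι => ℝ) P) :
    ∃ μ : Measure (ι → ℝ), IsProbabilityMeasure μ ∧ IsProjectiveLimit μ P := by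
  have hsub : (projectiveFamilyContent hP).IsSigmaSubadditive :=
    isSigmaSubadditive_of_addContent_iUnion_eq_tsum isSetRing_measurableCylinders
      fun f hf hf_Union hf' =>
        addContent_iUnion_eq_sum_of_tendsto_zero isSetRing_measurableCylinders
          (projectiveFamilyContent hP) (fun s hs => projectiveFamilyContent_ne_top _)
          (fun _ h1 h2 h3 => tendsto_projectiveFamilyContent_zero hP h1 h2 h3) hf hf_Union hf'
  let μ : Measure (ι → ℝ) := (projectiveFamilyContent hP).measure
    isSetSemiring_measurableCylinders generateFrom_measurableCylinders.ge hsub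
  have hμ : IsProjectiveLimit μ P := by
    intro I
    ext s hs
    rw [Measure.map_apply (Finset.measurable_restrict I) hs, AddContent.measure_eq, ← cylinder,
      projectiveFamilyContent_cylinder hP hs]
    · exact generateFrom_measurableCylinders.symm
    · exact cylinder_mem_measurableCylinders _ _ hs
  exact ⟨μ, hμ.isProbabilityMeasure, hμ⟩

end Kolmogorov

/-! ### Gaussian processes with prescribed covariance -/

section GaussianProcess

open WithLp

variable {Θ : Type*}

/-- The centered Gaussian law on `I → ℝ` whose covariance matrix is the restriction of `γ`. -/
noncomputable def gaussianFamily (γ : Θ → Θ → ℝ) (I : Finset Θ) : Measure (I → ℝ) :=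
  open Classical in
  (multivariateGaussian 0 (Matrix.of fun i j : I => γ i j)).map (ofLp (p := 2))

instance isProbabilityMeasure_gaussianFamily (γ : Θ → Θ → ℝ) (I : Finset Θ) :
    IsProbabilityMeasure (gaussianFamily γ I) :=
  Measure.isProbabilityMeasure_map (by fun_prop)

instance isGaussian_gaussianFamily (γ : Θ → Θ → ℝ) (I : Finset Θ) :
    IsGaussian (gaussianFamily γ I) := by
  rw [gaussianFamily, show (ofLp : EuclideanSpace ℝ I → I → ℝ) = ⇑(EuclideanSpace.equiv I ℝ)
    from rfl]
  infer_instance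

lemma isProjectiveMeasureFamily_gaussianFamily {γ : Θ → Θ → ℝ}
    (hγ : ∀ I : Finset Θ, (Matrix.of fun i j : I => γ i j).PosSemidef) :
    IsProjectiveMeasureFamily (α := fun _ : Θ => ℝ) (gaussianFamily γ) := by
  classical
  intro I J hJI
  have h := (measurePreserving_restrict₂_multivariateGaussian (μ := 0) (hγ I) hJI).map_eq
  rw [gaussianFamily, gaussianFamily,
    Measure.map_map (Finset.measurable_restrict₂ (X := fun _ : Θ => ℝ) hJI) (by fun_prop)]
  -- Marginals of a centered Gaussian law are centered Gaussian with the corresponding submatrix as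
  -- covariance; what remains is to transport this along `ofLp`.
  have h0 : EuclideanSpace.restrict₂ hJI (0 : EuclideanSpace ℝ I) = 0 := by simp
  rw [h0] at h
  have h1 : (Matrix.of fun i j : J => γ i j) = (Matrix.of fun i j : I => γ i j).submatrix
      (fun i : J => ⟨i.1, hJI i.2⟩) (fun i : J => ⟨i.1, hJI i.2⟩) := rfl
  have h2 : Finset.restrict₂ (π := fun _ => ℝ) hJI ∘ (ofLp : EuclideanSpace ℝ I → I → ℝ) =
      ofLp ∘ EuclideanSpace.restrict₂ hJI := by ext; simp
  rw [h2, ← Measure.map_map (by fun_prop) (by fun_prop)]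
  convert! congrArg (Measure.map (ofLp (p := 2))) h.symm using 2

/-- A positive semidefinite function is the covariance function of a centered Gaussian process. -/
theorem exists_isCenteredGaussianProcess {γ : Θ → Θ → ℝ}
    (hγ : ∀ I : Finset Θ, (Matrix.of fun i j : I => γ i j).PosSemidef) :
    ∃ P : Measure (Θ → ℝ), IsProbabilityMeasure P ∧
      IsCenteredGaussianProcess (fun θ z => z θ) P γ ∧
      ∀ I : Finset Θ, P.map I.restrict = gaussianFamily γ I := by
  classical
  obtain ⟨P, hP, hlim⟩ := exists_isProjectiveLimit (isProjectiveMeasureFamily_gaussianFamily hγ)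
  have hlaw : ∀ I : Finset Θ, HasLaw (fun z : Θ → ℝ => I.restrict z) (gaussianFamily γ I) P :=
    fun I => ⟨(Finset.measurable_restrict I).aemeasurable, hlim I⟩
  refine ⟨P, hP, ⟨⟨fun I => (hlaw I).hasGaussianLaw⟩, fun θ => ?_, fun θ₁ θ₂ => ?_⟩, hlim⟩
  · have h := (hlaw {θ}).integral_comp (f := fun x : ({θ} : Finset Θ) → ℝ => x ⟨θ, by simp⟩)
      (measurable_pi_apply _).aestronglyMeasurable
    have h2 : ∫ x : ({θ} : Finset Θ) → ℝ, x ⟨θ, by simp⟩ ∂gaussianFamily γ {θ} = 0 := by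
      rw [gaussianFamily, integral_map (by fun_prop)
        (measurable_pi_apply (X := fun _ : ({θ} : Finset Θ) => ℝ) _).aestronglyMeasurable]
      have := (EuclideanSpace.proj (𝕜 := ℝ)
        (⟨θ, by simp⟩ : ({θ} : Finset Θ))).integral_comp_comm
        (IsGaussian.integrable_id (μ := multivariateGaussian 0
          (Matrix.of fun i j : ({θ} : Finset Θ) => γ i j)))
      simpa using this
    exact h.trans h2
  · have h := (hlaw {θ₁, θ₂}).covariance_fun_comp
      (f := fun x : ({θ₁, θ₂} : Finset Θ) → ℝ => x ⟨θ₁, by simp⟩)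
      (g := fun x : ({θ₁, θ₂} : Finset Θ) → ℝ => x ⟨θ₂, by simp⟩)
      (measurable_pi_apply _).aemeasurable (measurable_pi_apply _).aemeasurable
    refine h.trans ?_
    rw [gaussianFamily, covariance_map
      (measurable_pi_apply (X := fun _ : ({θ₁, θ₂} : Finset Θ) => ℝ) _).aestronglyMeasurable
      (measurable_pi_apply (X := fun _ : ({θ₁, θ₂} : Finset Θ) => ℝ) _).aestronglyMeasurable (by fun_prop)]
    exact covariance_eval_multivariateGaussian (hγ _) _ _

end GaussianProcess

/-! ### Elementary estimates for the complex exponential -/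

section Elementary

open Complex

/-- Telescoping: factors are exchanged one at a time, and the others have norm at most one. -/
lemma norm_prod_sub_prod_le_sum {ι : Type*} (s : Finset ι) (a b : ι → ℂ)
    (ha : ∀ i ∈ s, ‖a i‖ ≤ 1) (hb : ∀ i ∈ s, ‖b i‖ ≤ 1) :
    ‖∏ i ∈ s, a i - ∏ i ∈ s, b i‖ ≤ ∑ i ∈ s, ‖a i - b i‖ := by
  classical
  induction s using Finset.induction_on with
  | empty => simp
  | insert j s hj ih =>
    rw [Finset.prod_insert hj, Finset.prod_insert hj, Finset.sum_insert hj]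
    have ih' := ih (fun i hi => ha i (Finset.mem_insert_of_mem hi))
      fun i hi => hb i (Finset.mem_insert_of_mem hi)
    have hB : ‖∏ i ∈ s, b i‖ ≤ 1 := by
      rw [norm_prod]
      exact Finset.prod_le_one (fun _ _ => norm_nonneg _)
        fun i hi => hb i (Finset.mem_insert_of_mem hi)
    calc ‖a j * ∏ i ∈ s, a i - b j * ∏ i ∈ s, b i‖
        = ‖(a j - b j) * ∏ i ∈ s, b i + a j * (∏ i ∈ s, a i - ∏ i ∈ s, b i)‖ := by
          congr 1; ring
      _ ≤ ‖a j - b j‖ * ‖∏ i ∈ s, b i‖ + ‖a j‖ * ‖∏ i ∈ s, a i - ∏ i ∈ s, b i‖ := by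
          refine (norm_add_le _ _).trans ?_
          rw [norm_mul, norm_mul]
      _ ≤ ‖a j - b j‖ * 1 + 1 * ‖∏ i ∈ s, a i - ∏ i ∈ s, b i‖ := by
          gcongr
          exact ha j (Finset.mem_insert_self _ _)
      _ ≤ _ := by linarith

lemma norm_one_add_mul_I_sq (x : ℝ) : ‖1 + (x : ℂ) * I‖ ^ 2 = 1 + x ^ 2 := by
  rw [← normSq_eq_norm_sq]
  have := normSq_add_mul_I 1 x
  simpa using this

/-- This is `1 + x² ≤ exp(x²)` after squaring. -/
lemma norm_one_add_mul_I_mul_exp_le_one (x : ℝ) :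
    ‖(1 + (x : ℂ) * I) * (Real.exp (-x ^ 2 / 2) : ℂ)‖ ≤ 1 := by
  rw [← sq_le_one_iff₀ (norm_nonneg _), norm_mul, mul_pow, norm_one_add_mul_I_sq, norm_real,
    Real.norm_of_nonneg (Real.exp_pos _).le, ← Real.exp_nat_mul]
  calc (1 + x ^ 2) * Real.exp ((2 : ℕ) * (-x ^ 2 / 2))
      ≤ Real.exp (x ^ 2) * Real.exp ((2 : ℕ) * (-x ^ 2 / 2)) := by
        gcongr
        linarith [Real.add_one_le_exp (x ^ 2)]
    _ = 1 := by
        rw [← Real.exp_add]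
        simp only [Nat.cast_ofNat, Real.exp_eq_one_iff]
        ring

lemma norm_exp_mul_I_sub_le {x : ℝ} (hx : |x| ≤ 1) :
    ‖exp (x * I) - (1 + (x : ℂ) * I) * (Real.exp (-x ^ 2 / 2) : ℂ)‖ ≤ 2 * |x| ^ 3 := by
  have h1 : ‖exp (x * I) - (1 + x * I - x ^ 2 / 2)‖ ≤ |x| ^ 3 := by
    have h := exp_bound (x := x * I) (n := 3) (by simpa using hx) (by norm_num)
    have e : ∑ m ∈ Finset.range 3, ((x : ℂ) * I) ^ m / (m.factorial : ℂ)
        = 1 + x * I - x ^ 2 / 2 := by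
      simp [Finset.sum_range_succ, mul_pow, Nat.factorial]
      ring
    rw [e] at h
    refine h.trans ?_
    have : ‖(x : ℂ) * I‖ = |x| := by simp
    rw [this]
    norm_num [Nat.factorial]
    nlinarith [pow_nonneg (abs_nonneg x) 3]
  have hy : |-x ^ 2 / 2| ≤ 1 := by
    rw [abs_le]
    have := sq_abs x
    constructor <;> nlinarith [abs_nonneg x]
  have h2 : |Real.exp (-x ^ 2 / 2) - (1 - x ^ 2 / 2)| ≤ |x| ^ 3 / 4 := by
    have h := Real.exp_bound hy (n := 2) (by norm_num)
    have e : ∑ m ∈ Finset.range 2, (-x ^ 2 / 2) ^ m / (m.factorial : ℝ) = 1 - x ^ 2 / 2 := by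
      simp [Finset.sum_range_succ]
      ring
    rw [e] at h
    refine h.trans ?_
    have : |-x ^ 2 / 2| = |x| ^ 2 / 2 := by
      rw [abs_div, abs_neg, abs_pow]; simp
    have h6 : |-x ^ 2 / 2| ^ 2 * (((2 : ℕ).succ : ℝ) / ((2 : ℕ).factorial * (2 : ℕ)))
        = |x| ^ 3 * |x| * (3 / 16) := by
      rw [this]
      norm_num [Nat.factorial]
      rw [← sq_abs x]
      ring
    rw [h6]
    nlinarith [pow_nonneg (abs_nonneg x) 3]
  have h3 : ‖1 + (x : ℂ) * I‖ ≤ 2 := by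
    refine (norm_add_le _ _).trans ?_
    simp
    linarith
  -- The second-order Taylor polynomials agree: `(1 + ix)(1 - x²/2) = 1 + ix - x²/2 - ix³/2`. The
  -- three errors contribute `1 + 1/2 + 2 · 1/4 = 2` times `|x|³`.
  have key : exp (x * I) - (1 + (x : ℂ) * I) * (Real.exp (-x ^ 2 / 2) : ℂ)
      = (exp (x * I) - (1 + x * I - x ^ 2 / 2)) + ((x ^ 3 / 2 : ℝ) : ℂ) * I
        - (1 + (x : ℂ) * I) * ((Real.exp (-x ^ 2 / 2) - (1 - x ^ 2 / 2) : ℝ) : ℂ) := by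
    push_cast
    ring
  rw [key]
  refine (norm_sub_le _ _).trans ((add_le_add_left (norm_add_le _ _) _).trans ?_)
  rw [norm_mul (1 + (x : ℂ) * I), norm_real, norm_mul, norm_real, norm_I, Real.norm_eq_abs,
    Real.norm_eq_abs]
  have h4 : |x ^ 3 / 2| = |x| ^ 3 / 2 := by rw [abs_div, abs_pow]; simp
  rw [h4]
  have h5 : ‖1 + (x : ℂ) * I‖ * |Real.exp (-x ^ 2 / 2) - (1 - x ^ 2 / 2)| ≤ 2 * (|x| ^ 3 / 4) := by
    gcongr
  linarith

lemma norm_exp_sum_sub_prod_mul_exp_le (n : ℕ) (x : ℕ → ℝ) {δ : ℝ} (hδ : δ ≤ 1)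
    (hx : ∀ k < n, |x k| ≤ δ) :
    ‖exp ((∑ k ∈ Finset.range n, x k : ℝ) * I)
      - (∏ k ∈ Finset.range n, (1 + (x k : ℂ) * I))
        * (Real.exp (-(∑ k ∈ Finset.range n, x k ^ 2) / 2) : ℂ)‖
      ≤ 2 * δ * ∑ k ∈ Finset.range n, x k ^ 2 := by
  have e1 : exp ((∑ k ∈ Finset.range n, x k : ℝ) * I)
      = ∏ k ∈ Finset.range n, exp (x k * I) := by
    rw [← exp_sum, ofReal_sum, Finset.sum_mul]
  have e2 : (∏ k ∈ Finset.range n, (1 + (x k : ℂ) * I))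
        * (Real.exp (-(∑ k ∈ Finset.range n, x k ^ 2) / 2) : ℂ)
      = ∏ k ∈ Finset.range n, ((1 + (x k : ℂ) * I) * (Real.exp (-x k ^ 2 / 2) : ℂ)) := by
    rw [Finset.prod_mul_distrib, ← ofReal_prod, ← Real.exp_sum, ← Finset.sum_div,
      Finset.sum_neg_distrib]
  rw [e1, e2]
  refine (norm_prod_sub_prod_le_sum _ _ _ (fun k _ => (norm_exp_ofReal_mul_I _).le)
    fun k _ => norm_one_add_mul_I_mul_exp_le_one _).trans ?_
  rw [Finset.mul_sum]
  refine Finset.sum_le_sum fun k hk => ?_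
  have hk' := hx k (Finset.mem_range.1 hk)
  refine (norm_exp_mul_I_sub_le (hk'.trans hδ)).trans ?_
  rw [← sq_abs (x k)]
  nlinarith [mul_le_mul_of_nonneg_right hk' (sq_nonneg |x k|)]

lemma abs_exp_neg_half_sub_le {u v : ℝ} (hu : 0 ≤ u) (hv : 0 ≤ v) :
    |Real.exp (-u / 2) - Real.exp (-v / 2)| ≤ |u - v| := by
  wlog h : u ≤ v generalizing u v
  · rw [abs_sub_comm, abs_sub_comm u]
    exact this hv hu (le_of_not_ge h)
  rw [abs_of_nonneg (sub_nonneg.2 (Real.exp_le_exp.2 (by linarith))),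
    abs_of_nonpos (by linarith)]
  have h1 : Real.exp (-v / 2) = Real.exp (-u / 2) * Real.exp (-(v - u) / 2) := by
    rw [← Real.exp_add]; ring_nf
  have h2 := Real.add_one_le_exp (-(v - u) / 2)
  have h3 : Real.exp (-u / 2) ≤ 1 := Real.exp_le_one_iff.2 (by linarith)
  have h4 := Real.exp_pos (-u / 2)
  rw [h1]
  nlinarith

end Elementary

/-! ### The truncated product -/

section Truncation

open Complex

/-- The sequence `x` set to zero as soon as the sum of its past squares exceeds `C`. -/
noncomputable def truncateBySquares (C : ℝ) (x : ℕ → ℝ) (k : ℕ) : ℝ :=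
  if ∑ j ∈ Finset.range k, x j ^ 2 ≤ C then x k else 0

/-- While the past squares sum to at most `C`, `1 + x² ≤ exp(x²)` bounds the product by `exp C`. At
most one further nontrivial factor follows, the one that crosses the level, and it costs `1 + b`.
The second conjunct carries the induction. -/
lemma prod_one_add_truncateBySquares_sq_le {C b : ℝ} (hb : 0 ≤ b) (hC : 0 ≤ C) (x : ℕ → ℝ) (n : ℕ)
    (hx : ∀ k < n, x k ^ 2 ≤ b) :
    ∏ k ∈ Finset.range n, (1 + truncateBySquares C x k ^ 2) ≤ Real.exp C * (1 + b) ∧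
      (∑ k ∈ Finset.range n, x k ^ 2 ≤ C →
        ∏ k ∈ Finset.range n, (1 + truncateBySquares C x k ^ 2)
          ≤ Real.exp (∑ k ∈ Finset.range n, x k ^ 2)) := by
  induction n with
  | zero =>
    simp only [Finset.range_zero, Finset.prod_empty, Finset.sum_empty, Real.exp_zero, le_refl,
      implies_true, and_true]
    nlinarith [Real.one_le_exp hC]
  | succ n ih =>
    obtain ⟨ih1, ih2⟩ := ih fun k hk => hx k (hk.trans (Nat.lt_succ_self n))
    have hxn := hx n (Nat.lt_succ_self n)
    rw [Finset.prod_range_succ, Finset.sum_range_succ]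
    by_cases h : ∑ j ∈ Finset.range n, x j ^ 2 ≤ C
    · have e : truncateBySquares C x n = x n := if_pos h
      rw [e]
      have h2 := ih2 h
      refine ⟨?_, fun _ => ?_⟩
      · refine mul_le_mul (h2.trans (Real.exp_le_exp.2 h)) (by linarith) (by positivity)
          (Real.exp_pos _).le
      · rw [Real.exp_add]
        refine mul_le_mul h2 ?_ (by positivity) (Real.exp_pos _).le
        linarith [Real.add_one_le_exp (x n ^ 2)]
    · have e : truncateBySquares C x n = 0 := if_neg h
      rw [e]
      refine ⟨by simpa using ih1, fun h' => absurd ?_ h⟩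
      nlinarith [sq_nonneg (x n)]

lemma norm_prod_truncateBySquares_le {C b : ℝ} (hb : 0 ≤ b) (hC : 0 ≤ C) (x : ℕ → ℝ) (n : ℕ)
    (hx : ∀ k < n, x k ^ 2 ≤ b) :
    ‖∏ k ∈ Finset.range n, (1 + (truncateBySquares C x k : ℂ) * I)‖ ≤ Real.exp C * (1 + b) := by
  have h := (prod_one_add_truncateBySquares_sq_le hb hC x n hx).1
  have hone : 1 ≤ ∏ k ∈ Finset.range n, (1 + truncateBySquares C x k ^ 2) :=
    Finset.one_le_prod fun k _ => by nlinarith [sq_nonneg (truncateBySquares C x k)]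
  have hsq : ‖∏ k ∈ Finset.range n, (1 + (truncateBySquares C x k : ℂ) * I)‖ ^ 2
      = ∏ k ∈ Finset.range n, (1 + truncateBySquares C x k ^ 2) := by
    rw [norm_prod, ← Finset.prod_pow]
    exact Finset.prod_congr rfl fun k _ => norm_one_add_mul_I_sq _
  rw [← hsq] at h hone
  -- The available bound is on the square of the norm; it passes to the norm because the norm is at
  -- least one.
  have h1 : 1 ≤ ‖∏ k ∈ Finset.range n, (1 + (truncateBySquares C x k : ℂ) * I)‖ :=
    (one_le_sq_iff₀ (norm_nonneg _)).1 hone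
  nlinarith

/-- Here the squares sum to at most `s + δ ≤ C`, so no factor is truncated. The expansion costs
`2δC`, and replacing the sum of squares by `s` costs `exp C * (1 + δ²) * δ`. -/
lemma norm_exp_sum_sub_prod_truncateBySquares_le {C s δ : ℝ} (hs : 0 ≤ s) (hδ0 : 0 ≤ δ)
    (hδ : δ ≤ 1) (hC : s + 1 ≤ C) (x : ℕ → ℝ) (n : ℕ) (hx : ∀ k < n, x k ^ 2 ≤ δ ^ 2)
    (hV : |∑ k ∈ Finset.range n, x k ^ 2 - s| ≤ δ) :
    ‖exp ((∑ k ∈ Finset.range n, x k : ℝ) * I) - (Real.exp (-s / 2) : ℂ) *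
      ∏ k ∈ Finset.range n, (1 + (truncateBySquares C x k : ℂ) * I)‖
      ≤ 2 * (C + Real.exp C) * δ := by
  have hVC : ∑ k ∈ Finset.range n, x k ^ 2 ≤ C := by linarith [(abs_le.1 hV).2]
  have hV0 : 0 ≤ ∑ k ∈ Finset.range n, x k ^ 2 := Finset.sum_nonneg fun _ _ => sq_nonneg _
  have htr : ∀ k ∈ Finset.range n, truncateBySquares C x k = x k := by
    intro k hk
    refine if_pos (le_trans ?_ hVC)
    exact Finset.sum_le_sum_of_subset_of_nonneg
      (Finset.range_subset_range.2 (Finset.mem_range.1 hk).le) fun _ _ _ => sq_nonneg _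
  have hT := norm_prod_truncateBySquares_le (sq_nonneg δ) (by linarith : 0 ≤ C) x n hx
  have e : ∏ k ∈ Finset.range n, (1 + (truncateBySquares C x k : ℂ) * I)
      = ∏ k ∈ Finset.range n, (1 + (x k : ℂ) * I) :=
    Finset.prod_congr rfl fun k hk => by rw [htr k hk]
  rw [e] at hT ⊢
  have h1 := norm_exp_sum_sub_prod_mul_exp_le n x hδ
    fun k hk => abs_le_of_sq_le_sq (hx k hk) hδ0
  have h2 : ‖(∏ k ∈ Finset.range n, (1 + (x k : ℂ) * I)) *
      ((Real.exp (-(∑ k ∈ Finset.range n, x k ^ 2) / 2) - Real.exp (-s / 2) : ℝ) : ℂ)‖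
      ≤ (Real.exp C * (1 + δ ^ 2)) * δ := by
    rw [norm_mul, norm_real, Real.norm_eq_abs]
    gcongr
    exact (abs_exp_neg_half_sub_le hV0 hs).trans hV
  have e2 : exp ((∑ k ∈ Finset.range n, x k : ℝ) * I) - (Real.exp (-s / 2) : ℂ) *
      ∏ k ∈ Finset.range n, (1 + (x k : ℂ) * I)
      = (exp ((∑ k ∈ Finset.range n, x k : ℝ) * I)
      - (∏ k ∈ Finset.range n, (1 + (x k : ℂ) * I))
        * (Real.exp (-(∑ k ∈ Finset.range n, x k ^ 2) / 2) : ℂ))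
      + (∏ k ∈ Finset.range n, (1 + (x k : ℂ) * I)) *
      ((Real.exp (-(∑ k ∈ Finset.range n, x k ^ 2) / 2) - Real.exp (-s / 2) : ℝ) : ℂ) := by
    push_cast
    ring
  rw [e2]
  refine (norm_add_le _ _).trans ((add_le_add h1 h2).trans ?_)
  have h3 : 2 * δ * ∑ k ∈ Finset.range n, x k ^ 2 ≤ 2 * δ * C := by gcongr
  have h4 : δ ^ 2 ≤ 1 := by nlinarith
  have h5 : Real.exp C * (1 + δ ^ 2) * δ ≤ Real.exp C * (1 + 1) * δ := by gcongr
  linarith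

end Truncation

/-! ### McLeish's central limit theorem -/

section MartingaleCLT

open Complex Topology

variable {Ω : Type*} {mΩ : MeasurableSpace Ω} {Q : Measure Ω} [IsProbabilityMeasure Q]

/-- The pull-out property, in its bilinear form because `f` is complex and `g` is real. -/
lemma integral_smul_eq_zero_of_condExp_eq_zero {m : MeasurableSpace Ω} (hm : m ≤ mΩ) {f : Ω → ℂ}
    {g : Ω → ℝ} (hf : StronglyMeasurable[m] f) (hg : Integrable g Q)
    (hfg : Integrable (fun ω => g ω • f ω) Q) (hcond : Q[g | m] =ᵐ[Q] 0) :
    ∫ ω, g ω • f ω ∂Q = 0 := by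
  have h := condExp_bilin_of_stronglyMeasurable_left (μ := Q)
    (ContinuousLinearMap.lsmul ℝ ℝ : ℝ →L[ℝ] ℂ →L[ℝ] ℂ).flip hf (by simpa using hfg) hg
  simp only [ContinuousLinearMap.flip_apply, ContinuousLinearMap.lsmul_apply] at h
  rw [← integral_condExp hm]
  refine integral_eq_zero_of_ae ?_
  filter_upwards [h, hcond] with ω h1 h2
  rw [h1, h2]
  simp

variable {ℱ : Filtration ℕ mΩ} {X : ℕ → Ω → ℝ}

lemma stronglyMeasurable_sum_sq (hX : ∀ k, StronglyMeasurable[ℱ (k + 1)] (X k)) (n : ℕ) :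
    StronglyMeasurable[ℱ n] fun ω => ∑ k ∈ Finset.range n, X k ω ^ 2 :=
  Finset.stronglyMeasurable_fun_sum _ fun k hk =>
    ((hX k).mono (ℱ.mono (Finset.mem_range.1 hk))).pow 2

lemma stronglyMeasurable_truncateBySquares (hX : ∀ k, StronglyMeasurable[ℱ (k + 1)] (X k)) (C : ℝ)
    (k : ℕ) : StronglyMeasurable[ℱ (k + 1)] fun ω => truncateBySquares C (fun j => X j ω) k := by
  refine StronglyMeasurable.ite ?_ (hX k) stronglyMeasurable_const
  exact ((stronglyMeasurable_sum_sq hX k).mono (ℱ.mono k.le_succ)).measurable measurableSet_Iic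

lemma stronglyMeasurable_prod_truncateBySquares (hX : ∀ k, StronglyMeasurable[ℱ (k + 1)] (X k))
    (C : ℝ) (n : ℕ) : StronglyMeasurable[ℱ n] fun ω =>
      ∏ k ∈ Finset.range n, (1 + (truncateBySquares C (fun j => X j ω) k : ℂ) * I) := by
  refine Finset.stronglyMeasurable_fun_prod _ fun k hk => ?_
  have h := (stronglyMeasurable_truncateBySquares hX C k).mono (ℱ.mono (Finset.mem_range.1 hk))
  exact stronglyMeasurable_const.add
    ((continuous_ofReal.comp_stronglyMeasurable h).mul stronglyMeasurable_const)

lemma integrable_prod_truncateBySquares (hX : ∀ k, StronglyMeasurable[ℱ (k + 1)] (X k))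
    {B : Ω → ℝ} (hBint : Integrable B Q) (hB0 : 0 ≤ B) {N : ℕ}
    (hB : ∀ᵐ ω ∂Q, ∀ k < N, X k ω ^ 2 ≤ B ω) {C : ℝ} (hC : 0 ≤ C) :
    Integrable (fun ω =>
      ∏ k ∈ Finset.range N, (1 + (truncateBySquares C (fun j => X j ω) k : ℂ) * I)) Q := by
  refine Integrable.mono' (g := fun ω => Real.exp C * (1 + B ω))
    (((integrable_const 1).add hBint).const_mul _)
    ((stronglyMeasurable_prod_truncateBySquares hX C N).mono (ℱ.le N)).aestronglyMeasurable ?_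
  filter_upwards [hB] with ω h
  exact norm_prod_truncateBySquares_le (hB0 ω) hC _ _ h

/-- The partial products form a martingale: whether the factor `n` is kept is decided by `ℱ n`, so
each new factor adds `X n` times an `ℱ n`-measurable function, which has mean zero. -/
lemma integral_prod_truncateBySquares (hX : ∀ k, StronglyMeasurable[ℱ (k + 1)] (X k))
    (hcond : ∀ k, Q[X k | ℱ k] =ᵐ[Q] 0) {B : Ω → ℝ} (hBint : Integrable B Q) (hB0 : 0 ≤ B)
    {C : ℝ} (hC : 0 ≤ C) (N : ℕ) (hB : ∀ᵐ ω ∂Q, ∀ k < N, X k ω ^ 2 ≤ B ω) :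
    ∫ ω, ∏ k ∈ Finset.range N, (1 + (truncateBySquares C (fun j => X j ω) k : ℂ) * I) ∂Q = 1 := by
  induction N with
  | zero => simp
  | succ n ih =>
    have hB' : ∀ᵐ ω ∂Q, ∀ k < n, X k ω ^ 2 ≤ B ω :=
      hB.mono fun ω h k hk => h k (hk.trans n.lt_succ_self)
    have ih := ih hB'
    set T : Ω → ℂ := fun ω =>
      ∏ k ∈ Finset.range n, (1 + (truncateBySquares C (fun j => X j ω) k : ℂ) * I) with hT
    have hTint : Integrable T Q := integrable_prod_truncateBySquares hX hBint hB0 hB' hC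
    have hTmeas : StronglyMeasurable[ℱ n] T := stronglyMeasurable_prod_truncateBySquares hX C n
    let f : Ω → ℂ := Set.indicator {ω | ∑ j ∈ Finset.range n, X j ω ^ 2 ≤ C} fun ω => T ω * I
    have hset : MeasurableSet[ℱ n] {ω | ∑ j ∈ Finset.range n, X j ω ^ 2 ≤ C} :=
      (stronglyMeasurable_sum_sq hX n).measurable measurableSet_Iic
    have hf : StronglyMeasurable[ℱ n] f :=
      (hTmeas.mul stronglyMeasurable_const).indicator hset
    have hXm : AEStronglyMeasurable (X n) Q := ((hX n).mono (ℱ.le _)).aestronglyMeasurable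
    have hXint : Integrable (X n) Q := by
      refine Integrable.mono' (g := fun ω => 1 + B ω) ((integrable_const 1).add hBint) hXm ?_
      filter_upwards [hB] with ω h
      have := h n n.lt_succ_self
      rw [Real.norm_eq_abs]
      nlinarith [sq_abs (X n ω), sq_nonneg (|X n ω| - 1)]
    have hprod : ∀ ω, ∏ k ∈ Finset.range (n + 1),
        (1 + (truncateBySquares C (fun j => X j ω) k : ℂ) * I) = T ω + X n ω • f ω := by
      intro ω
      rw [Finset.prod_range_succ]
      by_cases h : ∑ j ∈ Finset.range n, X j ω ^ 2 ≤ C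
      · have e1 : truncateBySquares C (fun j => X j ω) n = X n ω := if_pos h
        have e2 : f ω = T ω * I := Set.indicator_of_mem
          (show ω ∈ {ω | ∑ j ∈ Finset.range n, X j ω ^ 2 ≤ C} from h) _
        rw [e1, e2, real_smul]
        ring
      · have e1 : truncateBySquares C (fun j => X j ω) n = 0 := if_neg h
        have e2 : f ω = 0 := Set.indicator_of_notMem
          (show ω ∉ {ω | ∑ j ∈ Finset.range n, X j ω ^ 2 ≤ C} from h) _
        rw [e1, e2]
        simp [hT]
    -- A direct bound would involve `|X n| * (1 + B)`, which need not be integrable; the increment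
    -- is instead a difference of two dominated products.
    have hfg : Integrable (fun ω => X n ω • f ω) Q := by
      have h := (integrable_prod_truncateBySquares hX hBint hB0 hB hC).sub hTint
      refine h.congr (ae_of_all _ fun ω => ?_)
      simp only [Pi.sub_apply, hprod]
      ring
    simp_rw [hprod]
    rw [integral_add hTint hfg, ih,
      integral_smul_eq_zero_of_condExp_eq_zero (ℱ.le n) hf hXint hfg (hcond n), add_zero]

/-- A quantitative bound on the distance between the characteristic function at `1` of a sum of
martingale differences and that of the centered Gaussian law with variance `s`. -/
lemma norm_integral_exp_sum_sub_le (hX : ∀ k, StronglyMeasurable[ℱ (k + 1)] (X k))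
    (hcond : ∀ k, Q[X k | ℱ k] =ᵐ[Q] 0) {B : Ω → ℝ} (hBint : Integrable B Q) (hB0 : 0 ≤ B)
    (N : ℕ) (hB : ∀ᵐ ω ∂Q, ∀ k < N, X k ω ^ 2 ≤ B ω) {s δ : ℝ} (hs : 0 ≤ s) (hδ0 : 0 < δ)
    (hδ : δ ≤ 1) :
    ‖∫ ω, exp ((∑ k ∈ Finset.range N, X k ω : ℝ) * I) ∂Q - (Real.exp (-s / 2) : ℂ)‖
      ≤ 2 * (s + 1 + Real.exp (s + 1)) * δ
        + (1 + Real.exp (s + 1)) * Q.real {ω | δ ≤ ‖∑ k ∈ Finset.range N, X k ω ^ 2 - s‖}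
        + (1 + 2 * Real.exp (s + 1)) / δ ^ 2 * ∫ ω, B ω ∂Q := by
  set C := s + 1 with hCdef
  have hC : 0 ≤ C := by linarith
  set T : Ω → ℂ := fun ω =>
    ∏ k ∈ Finset.range N, (1 + (truncateBySquares C (fun j => X j ω) k : ℂ) * I) with hT
  have hTint : Integrable T Q := integrable_prod_truncateBySquares hX hBint hB0 hB hC
  have hT1 : ∫ ω, T ω ∂Q = 1 := integral_prod_truncateBySquares hX hcond hBint hB0 hC N hB
  have hXm : ∀ k, Measurable (X k) := fun k => ((hX k).mono (ℱ.le _)).measurable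
  have hSint : Integrable (fun ω => exp ((∑ k ∈ Finset.range N, X k ω : ℝ) * I)) Q := by
    refine Integrable.mono' (integrable_const (1 : ℝ)) ?_
      (ae_of_all _ fun ω => (norm_exp_ofReal_mul_I _).le)
    exact Measurable.aestronglyMeasurable (by fun_prop)
  set a : ℂ := (Real.exp (-s / 2) : ℂ) with ha
  have hanorm : ‖a‖ ≤ 1 := by
    rw [ha, norm_real, Real.norm_of_nonneg (Real.exp_pos _).le, Real.exp_le_one_iff]
    linarith
  set G : Set Ω := {ω | δ ≤ ‖∑ k ∈ Finset.range N, X k ω ^ 2 - s‖} with hG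
  have hGmeas : MeasurableSet G := measurableSet_le measurable_const (by fun_prop)
  -- Since `T` has mean exactly one, the constant `a` can be moved inside the integral as `a * T`.
  have e1 : ∫ ω, exp ((∑ k ∈ Finset.range N, X k ω : ℝ) * I) ∂Q - a
      = ∫ ω, (exp ((∑ k ∈ Finset.range N, X k ω : ℝ) * I) - a * T ω) ∂Q := by
    rw [integral_sub hSint (hTint.const_mul a), integral_const_mul, hT1, mul_one]
  have hE := (Real.exp_pos C).le
  -- If the sum of squares is near `s` and `B ≤ δ²`, the deterministic estimate applies. Otherwise
  -- the trivial bound `1 + exp C * (1 + B)` is charged to the indicator of `G` or, as in Markov's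
  -- inequality, to `B / δ²`.
  have hbound : ∀ᵐ ω ∂Q, ‖exp ((∑ k ∈ Finset.range N, X k ω : ℝ) * I) - a * T ω‖
      ≤ 2 * (C + Real.exp C) * δ + G.indicator (fun _ => 1 + Real.exp C) ω
        + (1 + 2 * Real.exp C) / δ ^ 2 * B ω := by
    filter_upwards [hB] with ω h
    have hTle : ‖T ω‖ ≤ Real.exp C * (1 + B ω) :=
      norm_prod_truncateBySquares_le (hB0 ω) hC _ _ h
    have htriv : ‖exp ((∑ k ∈ Finset.range N, X k ω : ℝ) * I) - a * T ω‖
        ≤ 1 + Real.exp C * (1 + B ω) := by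
      refine (norm_sub_le _ _).trans (add_le_add (norm_exp_ofReal_mul_I _).le ?_)
      rw [norm_mul]
      nlinarith [norm_nonneg a, norm_nonneg (T ω)]
    have hb0 : 0 ≤ B ω := hB0 ω
    have hδ2 : δ ^ 2 ≤ 1 := by nlinarith
    have h0 : 0 ≤ 2 * (C + Real.exp C) * δ := by positivity
    have hquot : (1 + 2 * Real.exp C) / δ ^ 2 * B ω = (1 + 2 * Real.exp C) * (B ω / δ ^ 2) := by
      ring
    have hBq : B ω ≤ B ω / δ ^ 2 := le_div_self hb0 (by positivity) hδ2
    by_cases hGω : ω ∈ G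
    · rw [Set.indicator_of_mem hGω, hquot]
      nlinarith
    · rw [Set.indicator_of_notMem hGω, hquot]
      by_cases hbδ : B ω ≤ δ ^ 2
      · have hV : |∑ k ∈ Finset.range N, X k ω ^ 2 - s| ≤ δ := (not_le.1 hGω).le
        have := norm_exp_sum_sub_prod_truncateBySquares_le hs hδ0.le hδ le_rfl (fun k => X k ω) N
          (fun k hk => (h k hk).trans hbδ) hV
        have h2 : 0 ≤ (1 + 2 * Real.exp C) * (B ω / δ ^ 2) := by positivity
        linarith
      · have h3 : 1 ≤ B ω / δ ^ 2 := (one_le_div (by positivity)).2 (not_le.1 hbδ).le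
        nlinarith
  have hint1 : Integrable (fun ω => 2 * (C + Real.exp C) * δ
      + G.indicator (fun _ => 1 + Real.exp C) ω) Q :=
    (integrable_const _).add ((integrable_const _).indicator hGmeas)
  have hint2 : Integrable (fun ω => (1 + 2 * Real.exp C) / δ ^ 2 * B ω) Q := hBint.const_mul _
  rw [e1]
  refine (norm_integral_le_of_norm_le (hint1.add hint2) hbound).trans (le_of_eq ?_)
  simp only [Pi.add_apply]
  rw [integral_add hint1 hint2, integral_add (integrable_const _)
    ((integrable_const _).indicator hGmeas), integral_indicator_const _ hGmeas,
    integral_const_mul (μ := Q) _ B]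
  simp [mul_comm]

/-- **McLeish's central limit theorem** for arrays of martingale differences, in terms of
characteristic functions. -/
theorem tendsto_integral_exp_sum_martingaleDifference {X : ℕ → ℕ → Ω → ℝ}
    (hX : ∀ n k, StronglyMeasurable[ℱ (k + 1)] (X n k))
    (hcond : ∀ n k, Q[X n k | ℱ k] =ᵐ[Q] 0) {s : ℝ} (hs : 0 ≤ s)
    (hV : TendstoInMeasure Q (fun n ω => ∑ k ∈ Finset.range n, X n k ω ^ 2) atTop fun _ => s)
    (hmax : ∀ η > 0, ∀ᶠ n in atTop, ∃ B : Ω → ℝ, Integrable B Q ∧ 0 ≤ B ∧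
      (∀ᵐ ω ∂Q, ∀ k < n, X n k ω ^ 2 ≤ B ω) ∧ ∫ ω, B ω ∂Q ≤ η) :
    Tendsto (fun n => ∫ ω, exp ((∑ k ∈ Finset.range n, X n k ω : ℝ) * I) ∂Q) atTop
      (𝓝 (Real.exp (-s / 2) : ℂ)) := by
  rw [tendstoInMeasure_iff_measureReal_norm] at hV
  rw [Metric.tendsto_nhds]
  intro ε hε
  have hE := Real.exp_pos (s + 1)
  set K := 2 * (s + 1 + Real.exp (s + 1)) with hK
  have hKpos : 0 < K := by positivity
  set δ := min 1 (ε / (4 * K)) with hδdef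
  have hδ0 : 0 < δ := lt_min one_pos (by positivity)
  have h1 : K * δ ≤ ε / 4 := by
    calc K * δ ≤ K * (ε / (4 * K)) := by gcongr; exact min_le_right _ _
      _ = ε / 4 := by field_simp
  -- Each of the three error terms is to be at most `ε / 4`.
  have hη : 0 < ε / 4 / ((1 + 2 * Real.exp (s + 1)) / δ ^ 2) := by positivity
  have hv : 0 < ε / 4 / (1 + Real.exp (s + 1)) := by positivity
  filter_upwards [(hV δ hδ0).eventually_lt_const hv, hmax _ hη] with n hn ⟨B, hBint, hB0, hB, hBle⟩
  rw [dist_eq_norm_sub]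
  refine (norm_integral_exp_sum_sub_le (hX n) (hcond n) hBint hB0 n hB hs hδ0
    (min_le_left _ _)).trans_lt ?_
  have h2 := (lt_div_iff₀' (by positivity)).1 hn
  have h3 := (le_div_iff₀' (by positivity)).1 hBle
  linarith

end MartingaleCLT

/-! ### Consequences of the Lindeberg condition -/

section Lindeberg

open Topology

variable {Θ Ω : Type*} {mΩ : MeasurableSpace Ω} {Q : Measure Ω}

lemma LindebergCondition.tendsto {d : ℕ → Θ → Ω → ℝ} (h : LindebergCondition Q d) (θ : Θ) {ε : ℝ}
    (hε : 0 < ε) : Tendsto (fun n : ℕ => (n : ℝ≥0∞)⁻¹ * ∑ k ∈ Finset.Icc 1 n,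
      ∫⁻ ω, Set.indicator {ω | ε * √(n : ℝ) < |d k θ ω|}
        (fun ω => ENNReal.ofReal (d k θ ω ^ 2)) ω ∂Q) atTop (𝓝 0) :=
  tendsto_of_le_liminf_of_limsup_le bot_le (h θ ε hε).le

/-- For one large `n ≥ k` the tail part of `d_k²` has finite expectation; off the tail `d_k² ≤ n`.
-/
lemma LindebergCondition.memLp [IsFiniteMeasure Q] {d : ℕ → Θ → Ω → ℝ}
    (h : LindebergCondition Q d) (hd : ∀ k θ, 1 ≤ k → AEStronglyMeasurable (d k θ) Q) {k : ℕ}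
    (hk : 1 ≤ k) (θ : Θ) : MemLp (d k θ) 2 Q := by
  have h1 : ∀ᶠ n : ℕ in atTop, (n : ℝ≥0∞)⁻¹ * ∑ k ∈ Finset.Icc 1 n,
      ∫⁻ ω, Set.indicator {ω | 1 * √(n : ℝ) < |d k θ ω|}
        (fun ω => ENNReal.ofReal (d k θ ω ^ 2)) ω ∂Q < 1 :=
    (h.tendsto θ one_pos).eventually_lt_const zero_lt_one
  obtain ⟨n, hn, hkn⟩ := (h1.and (eventually_ge_atTop k)).exists
  have hsum : ∑ k ∈ Finset.Icc 1 n, ∫⁻ ω, Set.indicator {ω | 1 * √(n : ℝ) < |d k θ ω|}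
        (fun ω => ENNReal.ofReal (d k θ ω ^ 2)) ω ∂Q ≠ ∞ := by
    intro htop
    rw [htop, ENNReal.mul_top (ENNReal.inv_ne_zero.2 (ENNReal.natCast_ne_top n))] at hn
    exact absurd hn (by simp)
  have hterm := (ENNReal.sum_ne_top.1 hsum) k (Finset.mem_Icc.2 ⟨hk, hkn⟩)
  rw [memLp_two_iff_integrable_sq (hd k θ hk)]
  refine ⟨(hd k θ hk).pow 2, ?_⟩
  rw [hasFiniteIntegral_iff_ofReal (ae_of_all _ fun ω => sq_nonneg _)]
  calc ∫⁻ ω, ENNReal.ofReal (d k θ ω ^ 2) ∂Q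
      ≤ ∫⁻ ω, (ENNReal.ofReal n + Set.indicator {ω | 1 * √(n : ℝ) < |d k θ ω|}
        (fun ω => ENNReal.ofReal (d k θ ω ^ 2)) ω) ∂Q := by
        refine lintegral_mono fun ω => ?_
        by_cases hω : 1 * √(n : ℝ) < |d k θ ω|
        · rw [Set.indicator_of_mem (show ω ∈ {ω | 1 * √(n : ℝ) < |d k θ ω|} from hω)]
          exact le_add_self
        · refine le_add_right (ENNReal.ofReal_le_ofReal ?_)
          rw [← sq_abs, ← Real.sq_sqrt n.cast_nonneg]
          exact pow_le_pow_left₀ (abs_nonneg _) (by simpa using hω) 2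
    _ < ∞ := by
        rw [lintegral_add_left measurable_const, ENNReal.add_lt_top]
        exact ⟨by simp [ENNReal.mul_lt_top_iff], hterm.lt_top⟩

lemma integral_sq_sub_condExp_le {Ω : Type*} {m mΩ : MeasurableSpace Ω} {Q : Measure Ω} [IsProbabilityMeasure Q]
    (hm : m ≤ mΩ)
    {u : Ω → ℝ} (hu : MemLp u 2 Q) :
    Integrable (fun ω => (u ω - (Q[u | m]) ω) ^ 2) Q ∧
      ∫ ω, (u ω - (Q[u | m]) ω) ^ 2 ∂Q ≤ ∫ ω, u ω ^ 2 ∂Q := by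
  have hint : Integrable (fun ω => (u ω - (Q[u | m]) ω) ^ 2) Q :=
    (hu.sub (hu.condExp one_le_two)).integrable_sq
  refine ⟨hint, ?_⟩
  have h := integral_mono_ae integrable_condVar integrable_condExp
    (condVar_ae_le_condExp_sq (μ := Q) hm hu)
  rw [integral_condExp hm] at h
  have h2 : ∫ ω, (Var[u; Q | m]) ω ∂Q = ∫ ω, (u ω - (Q[u | m]) ω) ^ 2 ∂Q := integral_condExp hm
  rw [h2] at h
  exact h

/-- Split `d` at level `c`. The bounded part is at most `2c` after centering, and `(a + b)² ≤ 2a² +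
2b²`. -/
lemma sub_condExp_sq_le {Ω : Type*} {m mΩ : MeasurableSpace Ω} {Q : Measure Ω} [IsProbabilityMeasure Q]
    {d : Ω → ℝ} (hd : Integrable d Q) (hdm : Measurable d) {c : ℝ} (hc : 0 ≤ c) :
    ∀ᵐ ω ∂Q, (d ω - (Q[d | m]) ω) ^ 2 ≤ 8 * c ^ 2 +
      2 * ({ω | c < |d ω|}.indicator d ω - (Q[{ω | c < |d ω|}.indicator d | m]) ω) ^ 2 := by
  set s : Set Ω := {ω | c < |d ω|} with hs
  have hsm : MeasurableSet s := measurableSet_lt measurable_const (by fun_prop)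
  have hdec : d = s.indicator d + sᶜ.indicator d := (Set.indicator_self_add_compl s d).symm
  have hbdd : ∀ ω, |sᶜ.indicator d ω| ≤ c := by
    intro ω
    by_cases h : ω ∈ s
    · simpa [h] using hc
    · rw [Set.indicator_of_mem (Set.mem_compl h)]
      exact not_lt.1 h
  have hadd := condExp_add (hd.indicator hsm) (hd.indicator hsm.compl) m
  rw [← hdec] at hadd
  have hcond := ae_bdd_abs_condExp_of_ae_bdd_abs (m := m) (ae_of_all Q hbdd)
  filter_upwards [hadd, hcond] with ω h1 h2
  have h3 := hbdd ω
  have h4 : d ω = s.indicator d ω + sᶜ.indicator d ω := congrFun hdec ω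
  rw [Pi.add_apply] at h1
  rw [h1, h4]
  have h5 := abs_le.1 h2
  have h6 := abs_le.1 h3
  set a := s.indicator d ω - (Q[s.indicator d | m]) ω
  set b := sᶜ.indicator d ω - (Q[sᶜ.indicator d | m]) ω with hb
  have hb2 : b ^ 2 ≤ (2 * c) ^ 2 := sq_le_sq' (by linarith) (by linarith)
  have e : s.indicator d ω + sᶜ.indicator d ω
      - ((Q[s.indicator d | m]) ω + (Q[sᶜ.indicator d | m]) ω) = a + b := by ring
  rw [e]
  nlinarith [sq_nonneg (a - b)]

/-- Under the Lindeberg condition, the maximum of the squared centered variables with indices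
`1 ≤ k ≤ n` is `o(n)` in mean. -/
lemma LindebergCondition.exists_bound_condCentered_sq [IsProbabilityMeasure Q]
    {ℱ : Filtration ℕ mΩ} {d : ℕ → Θ → Ω → ℝ} (h : LindebergCondition Q d)
    (hd : ∀ k θ, 1 ≤ k → Measurable (d k θ)) (θ : Θ) {η : ℝ} (hη : 0 < η) :
    ∀ᶠ n : ℕ in atTop, ∃ B : Ω → ℝ, Integrable B Q ∧ 0 ≤ B ∧
      (∀ᵐ ω ∂Q, ∀ k ∈ Finset.Icc 1 n, condCentered Q ℱ d k θ ω ^ 2 ≤ n * B ω) ∧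
      ∫ ω, B ω ∂Q ≤ η := by
  have hL2 : ∀ {k : ℕ}, 1 ≤ k → MemLp (d k θ) 2 Q := fun hk =>
    h.memLp (fun k θ hk => (hd k θ hk).aestronglyMeasurable) hk θ
  -- Chosen so that `8ε² = η/2`; the tails supply the other half through `2 · η/4`.
  set ε := √(η / 16) with hεdef
  have hε : 0 < ε := Real.sqrt_pos.2 (by positivity)
  have hε2 : ε ^ 2 = η / 16 := Real.sq_sqrt (by positivity)
  have hη4 : (0 : ℝ≥0∞) < ENNReal.ofReal (η / 4) := ENNReal.ofReal_pos.2 (by positivity)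
  filter_upwards [(h.tendsto θ hε).eventually_lt_const hη4, eventually_gt_atTop 0] with n hn hn0
  have hn0' : (0 : ℝ) < n := by exact_mod_cast hn0
  let s : ℕ → Set Ω := fun k => {ω | ε * √(n : ℝ) < |d k θ ω|}
  have hs : ∀ k ∈ Finset.Icc 1 n, MeasurableSet (s k) := fun k hk =>
    measurableSet_lt measurable_const ((hd k θ (Finset.mem_Icc.1 hk).1).norm)
  let u : ℕ → Ω → ℝ := fun k => (s k).indicator (d k θ)
  have hu : ∀ k ∈ Finset.Icc 1 n, MemLp (u k) 2 Q := fun k hk =>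
    (hL2 (Finset.mem_Icc.1 hk).1).indicator (hs k hk)
  let w : ℕ → Ω → ℝ := fun k ω => (u k ω - (Q[u k | ℱ (k - 1)]) ω) ^ 2
  have hw : ∀ k ∈ Finset.Icc 1 n, Integrable (w k) Q ∧ ∫ ω, w k ω ∂Q ≤ ∫ ω, u k ω ^ 2 ∂Q :=
    fun k hk => integral_sq_sub_condExp_le (ℱ.le _) (hu k hk)
  have htail : (n : ℝ)⁻¹ * ∑ k ∈ Finset.Icc 1 n, ∫ ω, u k ω ^ 2 ∂Q ≤ η / 4 := by
    have e : ∀ k ∈ Finset.Icc 1 n, ∫⁻ ω, (s k).indicator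
        (fun ω => ENNReal.ofReal (d k θ ω ^ 2)) ω ∂Q = ENNReal.ofReal (∫ ω, u k ω ^ 2 ∂Q) := by
      intro k hk
      rw [ofReal_integral_eq_lintegral_ofReal (hu k hk).integrable_sq
        (ae_of_all _ fun ω => sq_nonneg _)]
      refine lintegral_congr fun ω => ?_
      by_cases hω : ω ∈ s k <;> simp [u, hω]
    have hn' : (n : ℝ≥0∞)⁻¹ * ∑ k ∈ Finset.Icc 1 n, ∫⁻ ω, (s k).indicator
        (fun ω => ENNReal.ofReal (d k θ ω ^ 2)) ω ∂Q < ENNReal.ofReal (η / 4) := hn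
    rw [Finset.sum_congr rfl e, ← ENNReal.ofReal_sum_of_nonneg
      (fun k _ => integral_nonneg fun ω => sq_nonneg _), ← ENNReal.ofReal_natCast,
      ← ENNReal.ofReal_inv_of_pos hn0', ← ENNReal.ofReal_mul (by positivity)] at hn'
    exact ((ENNReal.ofReal_lt_ofReal_iff (by positivity)).1 hn').le
  -- The maximum of the centered tail squares is replaced by their sum, whose mean the Lindeberg
  -- condition controls.
  refine ⟨fun ω => 8 * ε ^ 2 + 2 * (n : ℝ)⁻¹ * ∑ k ∈ Finset.Icc 1 n, w k ω, ?_, ?_, ?_, ?_⟩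
  · exact (integrable_const _).add
      ((integrable_finsetSum _ fun k hk => (hw k hk).1).const_mul _)
  · intro ω
    have : 0 ≤ ∑ k ∈ Finset.Icc 1 n, w k ω := Finset.sum_nonneg fun k _ => sq_nonneg _
    simp only [Pi.zero_apply]
    positivity
  · have hae : ∀ᵐ ω ∂Q, ∀ k ∈ Finset.Icc 1 n, condCentered Q ℱ d k θ ω ^ 2
        ≤ 8 * (ε * √(n : ℝ)) ^ 2 + 2 * w k ω := by
      rw [Filter.eventually_all_finset]
      intro k hk
      have hk1 := (Finset.mem_Icc.1 hk).1
      exact sub_condExp_sq_le ((hL2 hk1).integrable one_le_two) (hd k θ hk1) (by positivity)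
    filter_upwards [hae] with ω hω k hk
    refine (hω k hk).trans ?_
    have h1 : w k ω ≤ ∑ k ∈ Finset.Icc 1 n, w k ω :=
      Finset.single_le_sum (f := fun k => w k ω) (fun k _ => sq_nonneg _) hk
    rw [mul_pow, Real.sq_sqrt hn0'.le]
    have e : (n : ℝ) * (8 * ε ^ 2 + 2 * (n : ℝ)⁻¹ * ∑ k ∈ Finset.Icc 1 n, w k ω)
        = 8 * (ε ^ 2 * n) + 2 * ∑ k ∈ Finset.Icc 1 n, w k ω := by
      field_simp
    rw [e]
    linarith
  · rw [integral_add (integrable_const _)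
      ((integrable_finsetSum _ fun k hk => (hw k hk).1).const_mul _), integral_const_mul
        (2 * (n : ℝ)⁻¹), integral_finsetSum _ fun k hk => (hw k hk).1]
    have h1 : ∑ k ∈ Finset.Icc 1 n, ∫ ω, w k ω ∂Q ≤ ∑ k ∈ Finset.Icc 1 n, ∫ ω, u k ω ^ 2 ∂Q :=
      Finset.sum_le_sum fun k hk => (hw k hk).2
    have h2 := mul_le_mul_of_nonneg_left h1 (inv_nonneg.2 hn0'.le)
    simp only [integral_const, probReal_univ, one_smul]
    rw [hε2]
    linarith

end Lindeberg

/-! ### Limits in probability -/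

section ConvergenceInMeasure

open Topology

variable {Ω : Type*} {mΩ : MeasurableSpace Ω} {Q : Measure Ω}

lemma tendstoInMeasure_finsetSum_const_mul {ι : Type*} (s : Finset ι) (c : ι → ℝ)
    {f : ι → ℕ → Ω → ℝ} {g : ι → Ω → ℝ} (h : ∀ i ∈ s, TendstoInMeasure Q (f i) atTop (g i)) :
    TendstoInMeasure Q (fun n ω => ∑ i ∈ s, c i * f i n ω) atTop
      fun ω => ∑ i ∈ s, c i * g i ω := by
  rw [tendstoInMeasure_iff_norm]
  intro ε hε
  have hc : 0 ≤ ∑ i ∈ s, |c i| := Finset.sum_nonneg fun _ _ => abs_nonneg _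
  -- The added 1 covers vanishing coefficients and makes the final inequality strict.
  set ε' := ε / (∑ i ∈ s, |c i| + 1) with hε'
  have hε'0 : 0 < ε' := by positivity
  have hlim : Tendsto (fun n => ∑ i ∈ s, Q {ω | ε' ≤ ‖f i n ω - g i ω‖}) atTop (𝓝 0) := by
    have := tendsto_finsetSum s fun i hi => tendstoInMeasure_iff_norm.1 (h i hi) ε' hε'0
    simpa using this
  refine tendsto_of_tendsto_of_tendsto_of_le_of_le tendsto_const_nhds hlim
    (fun _ => zero_le) fun n => ?_
  refine (measure_mono fun ω hω => ?_).trans (measure_biUnion_finset_le s _)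
  by_contra hcon
  simp only [Set.mem_iUnion, Set.mem_ofPred_eq, exists_prop, not_exists, not_and, not_le] at hcon hω
  rw [← Finset.sum_sub_distrib] at hω
  have h1 : ‖∑ i ∈ s, (c i * f i n ω - c i * g i ω)‖ ≤ ∑ i ∈ s, |c i| * ε' := by
    refine (norm_sum_le _ _).trans (Finset.sum_le_sum fun i hi => ?_)
    rw [← mul_sub, norm_mul, Real.norm_eq_abs]
    exact mul_le_mul_of_nonneg_left (hcon i hi).le (abs_nonneg _)
  rw [← Finset.sum_mul] at h1
  have h2 : (∑ i ∈ s, |c i|) * ε' < ε := by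
    rw [hε', mul_div_assoc', div_lt_iff₀ (by positivity)]
    nlinarith
  linarith

lemma nonneg_of_tendstoInMeasure_const [IsProbabilityMeasure Q] {f : ℕ → Ω → ℝ} {a : ℝ}
    (hf : ∀ n ω, 0 ≤ f n ω) (h : TendstoInMeasure Q f atTop fun _ => a) : 0 ≤ a := by
  obtain ⟨ns, -, hns⟩ := h.exists_seq_tendsto_ae
  obtain ⟨ω, hω⟩ := hns.exists
  exact ge_of_tendsto' hω fun n => hf _ ω

lemma eq_of_tendstoInMeasure_const [IsProbabilityMeasure Q] {f : ℕ → Ω → ℝ} {a b : ℝ}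
    (ha : TendstoInMeasure Q f atTop fun _ => a) (hb : TendstoInMeasure Q f atTop fun _ => b) :
    a = b :=
  (tendstoInMeasure_ae_unique ha hb).exists.choose_spec

end ConvergenceInMeasure

/-! ### Empirical covariances as quadratic forms -/

section EmpiricalCovariance

variable {Θ Ω : Type*} {mΩ : MeasurableSpace Ω} {Q : Measure Ω}
  {e : ℕ → Θ → Ω → ℝ} {γ : Θ → Θ → ℝ}

lemma empiricalCov_comm (e : ℕ → Θ → Ω → ℝ) (n : ℕ) (θ₁ θ₂ : Θ) :
    empiricalCov e n θ₁ θ₂ = empiricalCov e n θ₂ θ₁ := by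
  funext ω
  simp only [empiricalCov, mul_comm]

lemma sum_sq_eq_sum_empiricalCov {ι : Type*} [Fintype ι] (e : ℕ → Θ → Ω → ℝ) (θ : ι → Θ)
    (t : ι → ℝ) (n : ℕ) (ω : Ω) :
    ∑ k ∈ Finset.range n, ((√(n : ℝ))⁻¹ * ∑ i, t i * e (k + 1) (θ i) ω) ^ 2
      = ∑ p : ι × ι, t p.1 * t p.2 * empiricalCov e n (θ p.1) (θ p.2) ω := by
  have h1 : ∀ k, ((√(n : ℝ))⁻¹ * ∑ i, t i * e (k + 1) (θ i) ω) ^ 2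
      = ∑ p : ι × ι, t p.1 * t p.2 * ((n : ℝ)⁻¹ * (e (k + 1) (θ p.1) ω * e (k + 1) (θ p.2) ω)) := by
    intro k
    rw [mul_pow, inv_pow, Real.sq_sqrt n.cast_nonneg, sq, Finset.sum_mul_sum,
      ← Fintype.sum_prod_type', Finset.mul_sum]
    exact Finset.sum_congr rfl fun p _ => by ring
  simp_rw [h1]
  rw [Finset.sum_comm]
  refine Finset.sum_congr rfl fun p _ => ?_
  rw [empiricalCov, ← Finset.mul_sum, ← Finset.mul_sum, Finset.range_eq_Ico,
    Finset.sum_Ico_add' (fun k => e k (θ p.1) ω * e k (θ p.2) ω) 0 n 1]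
  rfl

lemma tendstoInMeasure_sum_sq {ι : Type*} [Fintype ι]
    (hγ : ∀ θ₁ θ₂, TendstoInMeasure Q (fun n => empiricalCov e n θ₁ θ₂) atTop fun _ => γ θ₁ θ₂)
    (θ : ι → Θ) (t : ι → ℝ) :
    TendstoInMeasure Q (fun n ω =>
        ∑ k ∈ Finset.range n, ((√(n : ℝ))⁻¹ * ∑ i, t i * e (k + 1) (θ i) ω) ^ 2) atTop
      fun _ => ∑ p : ι × ι, t p.1 * t p.2 * γ (θ p.1) (θ p.2) := by
  simp_rw [sum_sq_eq_sum_empiricalCov]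
  exact tendstoInMeasure_finsetSum_const_mul _ _ fun p _ => hγ _ _

lemma dotProduct_mulVec_of_eq_sum {ι : Type*} [Fintype ι] (A : ι → ι → ℝ) (t : ι → ℝ) :
    t ⬝ᵥ (Matrix.of A).mulVec t = ∑ p : ι × ι, t p.1 * t p.2 * A p.1 p.2 := by
  rw [Fintype.sum_prod_type]
  simp only [dotProduct, Matrix.mulVec, Matrix.of_apply, Finset.mul_sum]
  exact Finset.sum_congr rfl fun i _ => Finset.sum_congr rfl fun j _ => by ring

/-- A limit in probability of empirical covariance functions is positive semidefinite. -/
lemma posSemidef_of_tendstoInMeasure_empiricalCov [IsProbabilityMeasure Q]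
    (hγ : ∀ θ₁ θ₂, TendstoInMeasure Q (fun n => empiricalCov e n θ₁ θ₂) atTop fun _ => γ θ₁ θ₂)
    (I : Finset Θ) : (Matrix.of fun i j : I => γ i j).PosSemidef := by
  refine Matrix.PosSemidef.of_dotProduct_mulVec_nonneg ?_ fun t => ?_
  · ext i j
    simp only [Matrix.conjTranspose_apply, Matrix.of_apply, star_trivial]
    -- Symmetry of `γ` is inherited from the empirical covariances by uniqueness of limits in
    -- probability.
    refine eq_of_tendstoInMeasure_const (hγ _ _) ?_
    simp_rw [empiricalCov_comm e _ (j : Θ) i]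
    exact hγ _ _
  · rw [star_trivial, dotProduct_mulVec_of_eq_sum]
    exact nonneg_of_tendstoInMeasure_const
      (fun n ω => Finset.sum_nonneg fun k _ => sq_nonneg _)
      (tendstoInMeasure_sum_sq hγ (fun i : I => (i : Θ)) t)

end EmpiricalCovariance

/-! ### Reduction to one dimension -/

section CramerWold

open Topology WithLp

variable {Θ Ω : Type*} {mΩ : MeasurableSpace Ω} {Q : Measure Ω}
  {ℱ : Filtration ℕ mΩ} {d : ℕ → Θ → Ω → ℝ} {γ : Θ → Θ → ℝ}

lemma stronglyMeasurable_condCentered (hd : ∀ k θ, 1 ≤ k → Measurable[ℱ k] (d k θ)) (k : ℕ)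
    (θ : Θ) : StronglyMeasurable[ℱ (k + 1)] (condCentered Q ℱ d (k + 1) θ) :=
  (hd _ θ k.succ_pos).stronglyMeasurable.sub (stronglyMeasurable_condExp.mono (ℱ.mono k.le_succ))

lemma condExp_condCentered [IsProbabilityMeasure Q] {k : ℕ} {θ : Θ} (hd : Integrable (d (k + 1) θ) Q) :
    Q[condCentered Q ℱ d (k + 1) θ | ℱ k] =ᵐ[Q] 0 := by
  have h := condExp_sub hd (integrable_condExp (f := d (k + 1) θ) (m := ℱ k)) (ℱ k)
  rw [condExp_of_stronglyMeasurable (ℱ.le k) stronglyMeasurable_condExp integrable_condExp,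
    sub_self] at h
  exact h

lemma integrable_condCentered {k : ℕ} {θ : Θ} (hd : Integrable (d k θ) Q) :
    Integrable (condCentered Q ℱ d k θ) Q :=
  hd.sub integrable_condExp

/-- One-dimensional projections of the normalized sums satisfy the central limit theorem. -/
lemma tendsto_integral_exp_sum_normalizedSum [IsProbabilityMeasure Q] {ι : Type*} [Fintype ι]
    (hd : ∀ k θ, 1 ≤ k → Measurable[ℱ k] (d k θ)) (hL : LindebergCondition Q d)
    (hγ : ∀ θ₁ θ₂, TendstoInMeasure Q (fun n => empiricalCov (condCentered Q ℱ d) n θ₁ θ₂) atTop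
      fun _ => γ θ₁ θ₂) (θ : ι → Θ) (t : ι → ℝ) :
    Tendsto (fun n => ∫ ω, Complex.exp
      ((∑ i, t i * normalizedSum (condCentered Q ℱ d) n (θ i) ω : ℝ) * Complex.I) ∂Q) atTop
      (𝓝 (Real.exp (-(∑ p : ι × ι, t p.1 * t p.2 * γ (θ p.1) (θ p.2)) / 2) : ℂ)) := by
  set e := condCentered Q ℱ d with he
  have hdm : ∀ k θ, 1 ≤ k → Measurable (d k θ) := fun k θ hk => (hd k θ hk).mono (ℱ.le k) le_rfl
  have hdint : ∀ k θ, Integrable (d (k + 1) θ) Q := fun k θ =>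
    (hL.memLp (fun k θ hk => (hdm k θ hk).aestronglyMeasurable) k.succ_pos θ).integrable one_le_two
  -- The shift to `k + 1` matches `range n` with `Icc 1 n`, and makes `ℱ k` the past of the entry
  -- `k`.
  let X : ℕ → ℕ → Ω → ℝ := fun n k ω => (√(n : ℝ))⁻¹ * ∑ i, t i * e (k + 1) (θ i) ω
  have hsum : ∀ n ω, ∑ i, t i * normalizedSum e n (θ i) ω = ∑ k ∈ Finset.range n, X n k ω := by
    intro n ω
    simp only [normalizedSum, X]
    rw [← Finset.mul_sum, Finset.sum_comm, Finset.mul_sum]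
    refine Finset.sum_congr rfl fun i _ => ?_
    rw [← Finset.mul_sum, Finset.range_eq_Ico,
      Finset.sum_Ico_add' (fun k => e k (θ i) ω) 0 n 1]
    rw [mul_left_comm]
    rfl
  simp_rw [hsum]
  refine tendsto_integral_exp_sum_martingaleDifference (ℱ := ℱ) (X := X) (fun n k => ?_)
    (fun n k => ?_) ?_ (tendstoInMeasure_sum_sq hγ θ t) fun η hη => ?_
  · exact stronglyMeasurable_const.mul (Finset.stronglyMeasurable_fun_sum _ fun i _ =>
      stronglyMeasurable_const.mul (stronglyMeasurable_condCentered hd k (θ i)))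
  · have hX : X n k = (√(n : ℝ))⁻¹ • ∑ i, t i • e (k + 1) (θ i) := by
      funext ω
      simp [X]
    have h1 : Q[∑ i, t i • e (k + 1) (θ i) | ℱ k] =ᵐ[Q] 0 := by
      refine (condExp_finsetSum
        (fun i _ => (integrable_condCentered (hdint k (θ i))).smul (t i)) _).trans ?_
      have h2 : ∀ᵐ ω ∂Q, ∀ i, (Q[t i • e (k + 1) (θ i) | ℱ k]) ω = 0 := by
        refine ae_all_iff.2 fun i => ?_
        filter_upwards [condExp_smul (μ := Q) (t i) (e (k + 1) (θ i)) (ℱ k),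
          condExp_condCentered (ℱ := ℱ) (hdint k (θ i))] with ω h3 h4
        rw [h3, Pi.smul_apply, h4]
        simp
      filter_upwards [h2] with ω h3
      rw [Finset.sum_apply]
      exact Finset.sum_eq_zero fun i _ => h3 i
    rw [hX]
    filter_upwards [condExp_smul (μ := Q) (√(n : ℝ))⁻¹ (∑ i, t i • e (k + 1) (θ i)) (ℱ k), h1]
      with ω h3 h4
    rw [h3, Pi.smul_apply, h4]
    simp
  · exact nonneg_of_tendstoInMeasure_const (fun n ω => Finset.sum_nonneg fun k _ => sq_nonneg _)
      (tendstoInMeasure_sum_sq hγ θ t)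
  -- By Cauchy–Schwarz `(∑ t i²) ∑ B i` dominates the squares; if each `B i` has mean at most `η /
  -- (K + 1)`, its mean is at most `K η / (K + 1) ≤ η`. The added 1 allows `K = 0`.
  · set K := (∑ i, t i ^ 2) * Fintype.card ι with hK
    have ht : 0 ≤ ∑ i, t i ^ 2 := Finset.sum_nonneg fun _ _ => sq_nonneg _
    have hK0 : 0 ≤ K := by positivity
    have hη' : 0 < η / (K + 1) := by positivity
    have hev := eventually_all.2 fun i => hL.exists_bound_condCentered_sq (ℱ := ℱ) hdm (θ i) hη'
    filter_upwards [hev, eventually_gt_atTop 0] with n hn hn0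
    have hn0' : (0 : ℝ) < n := by exact_mod_cast hn0
    choose B hBint hB0 hB hBle using hn
    refine ⟨fun ω => (∑ i, t i ^ 2) * ∑ i, B i ω,
      (integrable_finsetSum _ fun i _ => hBint i).const_mul _,
      fun ω => mul_nonneg ht (Finset.sum_nonneg fun i _ => hB0 i ω), ?_, ?_⟩
    · filter_upwards [ae_all_iff.2 hB] with ω hω k hk
      have h1 := Finset.sum_mul_sq_le_sq_mul_sq Finset.univ t fun i => e (k + 1) (θ i) ω
      have h2 : ∑ i, e (k + 1) (θ i) ω ^ 2 ≤ n * ∑ i, B i ω := by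
        rw [Finset.mul_sum]
        exact Finset.sum_le_sum fun i _ =>
          hω i (k + 1) (Finset.mem_Icc.2 ⟨k.succ_pos, hk⟩)
      simp only [X]
      rw [mul_pow, inv_pow, Real.sq_sqrt hn0'.le, inv_mul_le_iff₀ hn0']
      calc _ ≤ _ := h1
        _ ≤ (∑ i, t i ^ 2) * (n * ∑ i, B i ω) := by gcongr
        _ = _ := by ring
    · rw [integral_const_mul, integral_finsetSum _ fun i _ => hBint i]
      calc (∑ i, t i ^ 2) * ∑ i, ∫ ω, B i ω ∂Q
          ≤ (∑ i, t i ^ 2) * ∑ _i : ι, η / (K + 1) := by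
            gcongr with i
            exact hBle i
        _ = K * η / (K + 1) := by
            rw [Finset.sum_const, Finset.card_univ, nsmul_eq_mul, hK]
            ring
        _ ≤ η := by
            rw [div_le_iff₀ (by positivity)]
            nlinarith

/-- The finite-dimensional distributions of the normalized sums converge to centered Gaussian
laws. -/
lemma tendstoInDistribution_restrict_normalizedSum [IsProbabilityMeasure Q]
    (hd : ∀ k θ, 1 ≤ k → Measurable[ℱ k] (d k θ)) (hL : LindebergCondition Q d)
    (hγ : ∀ θ₁ θ₂, TendstoInMeasure Q (fun n => empiricalCov (condCentered Q ℱ d) n θ₁ θ₂) atTop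
      fun _ => γ θ₁ θ₂) (I : Finset Θ) {P : Measure (Θ → ℝ)} [IsProbabilityMeasure P]
    (hP : P.map I.restrict = gaussianFamily γ I) :
    TendstoInDistribution (fun n ω => I.restrict (normalizedSum (condCentered Q ℱ d) n · ω)) atTop
      (fun z => I.restrict z) (fun _ => Q) P := by
  classical
  have hpsd := posSemidef_of_tendstoInMeasure_empiricalCov hγ I
  have hmeas : ∀ n θ, Measurable (normalizedSum (condCentered Q ℱ d) n θ) := by
    intro n θ
    refine measurable_const.mul (Finset.measurable_fun_sum _ fun k hk => ?_)
    obtain ⟨k, rfl⟩ := Nat.exists_eq_add_of_le' (Finset.mem_Icc.1 hk).1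
    exact ((stronglyMeasurable_condCentered hd k θ).mono (ℱ.le _)).measurable
  -- Characteristic functions require an inner product, so the vectors are moved to Euclidean space
  -- and brought back by the continuous map `ofLp` at the end.
  have hD : ∀ n, Measurable fun ω => toLp 2 fun i : I =>
      normalizedSum (condCentered Q ℱ d) n i ω := fun n =>
    (WithLp.measurable_toLp 2 _).comp (measurable_pi_lambda _ fun i => hmeas n i)
  have hZ : Measurable fun z : Θ → ℝ => toLp 2 (I.restrict z) :=
    (WithLp.measurable_toLp 2 _).comp (Finset.measurable_restrict I)
  have hlaw : P.map (fun z : Θ → ℝ => toLp 2 (I.restrict z))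
      = multivariateGaussian 0 (Matrix.of fun i j : I => γ i j) := by
    have h1 := Measure.map_map (μ := P) (WithLp.measurable_toLp 2 (I → ℝ))
      (Finset.measurable_restrict (X := fun _ : Θ => ℝ) I)
    rw [hP, gaussianFamily, Measure.map_map (by fun_prop) (by fun_prop)] at h1
    refine h1.symm.trans ?_
    convert! Measure.map_id using 2
  have key : TendstoInDistribution
      (fun n ω => toLp 2 fun i : I => normalizedSum (condCentered Q ℱ d) n i ω) atTop
      (fun z : Θ → ℝ => toLp 2 (I.restrict z)) (fun _ => Q) P := by
    refine ⟨fun n => (hD n).aemeasurable, hZ.aemeasurable, ?_⟩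
    -- The characteristic function at `t` is that of the projection along `t`, evaluated at 1.
    refine ProbabilityMeasure.tendsto_iff_tendsto_charFun.2 fun t => ?_
    have h1 := tendsto_integral_exp_sum_normalizedSum hd hL hγ (fun i : I => (i : Θ)) t
    have h2 : charFun (P.map fun z : Θ → ℝ => toLp 2 (I.restrict z)) t
        = (Real.exp (-(∑ p : I × I, t p.1 * t p.2 * γ p.1 p.2) / 2) : ℂ) := by
      rw [hlaw, charFun_multivariateGaussian hpsd, dotProduct_mulVec_of_eq_sum]
      simp [neg_div]
    simp only [ProbabilityMeasure.coe_mk]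
    rw [h2]
    refine h1.congr fun n => ?_
    rw [charFun_apply, integral_map (hD n).aemeasurable (by fun_prop)]
    simp [PiLp.inner_apply]
  have := key.continuous_comp (PiLp.continuous_ofLp 2 fun _ : I => ℝ)
  exact this

end CramerWold

/-! ### Conclusion -/

theorem proposition2 {Ω : Type*} {mΩ : MeasurableSpace Ω} (Q : Measure Ω) [IsProbabilityMeasure Q]
    {𝒳 𝒴 Θ : Type*} [MeasurableSpace 𝒳] [MeasurableSpace 𝒴]
    (ℱ : Filtration ℕ mΩ) (x₁ x₂ : ℕ → Ω → 𝒳) (y : ℕ → Ω → 𝒴)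
    (hx₁ : ∀ k, 1 ≤ k → Measurable[ℱ k] (x₁ k)) (hx₂ : ∀ k, 1 ≤ k → Measurable[ℱ k] (x₂ k))
    (hy : ∀ k, 1 ≤ k → Measurable[ℱ k] (y k))
    (S : Θ → 𝒳 → 𝒴 → ℝ) (hS : ∀ θ, Measurable (Function.uncurry (S θ)))
    (γ : Θ → Θ → ℝ) (hγ_pos : ∀ θ, 0 < γ θ θ)
    (hγ : ∀ θ₁ θ₂, TendstoInMeasure Q
      (fun n => empiricalCov (condCentered Q ℱ (scoreDiff S x₁ x₂ y)) n θ₁ θ₂) atTop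
      (fun _ => γ θ₁ θ₂))
    (hA0 : LindebergCondition Q (scoreDiff S x₁ x₂ y)) :
    ∃ (P : Measure (Θ → ℝ)) (_ : IsProbabilityMeasure P),
      IsCenteredGaussianProcess (fun θ z => z θ) P γ ∧
      TendstoInFiniteDimDistributions
        (normalizedSum (condCentered Q ℱ (scoreDiff S x₁ x₂ y))) (fun θ z => z θ) Q P := by
  obtain ⟨P, hP, hgauss, hlaw⟩ :=
    exists_isCenteredGaussianProcess (posSemidef_of_tendstoInMeasure_empiricalCov hγ)
  refine ⟨P, hP, hgauss, fun I =>
    tendstoInDistribution_restrict_normalizedSum (fun k θ hk => ?_) hA0 hγ I (hlaw I)⟩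
  exact ((hS θ).comp ((hx₁ k hk).prodMk (hy k hk))).sub
    ((hS θ).comp ((hx₂ k hk).prodMk (hy k hk)))
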